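/- Let $p\ge 1$ be an integer and let $D$ be the derivative operator. For a vector $\mathbf a=(\mathbf a(0),\mathbf a(1),\dots)$ of nonnegative integers with finitely many nonzero entries, write $|\mathbf a|=\sum_i \mathbf a(i)$, $\mathbf a\cdot\mathbf n=\sum_i i\,\mathbf a(i)$, and $f^{\mathbf a}=\prod_i (f^{(i)})^{\mathbf a(i)}$, where $f^{(i)}=D^i f$. Let $\mathbf e_m$ be the vector whose only nonzero entry is a $1$ in position $m$ (positions start at $0$), and let $\Lambda_p=\{\mathbf a : |\mathbf a|=p-1,\ \mathbf a\cdot\mathbf n<p\}$. For $\mathbf a\in\Lambda_p$ let $\gamma_{p;\mathbf a}$ be the coefficient of $f^{\mathbf a+\mathbf e_0}D^{\,p-\mathbf a\cdot\mathbf n}$ in the expansion $$(fD)^p=\sum_{\mathbf a\in\Lambda_p}\gamma_{p;\mathbf a}\,f^{\mathbf a+\mathbf e_0}\,D^{\,p-\mathbf a\cdot\mathbf n}$$ for generic $f$ (that is, $f,f^{(1)},f^{(2)},\dots$ are treated as independent indeterminates), and put $\gamma_{p;\mathbf a}=0$ for $\mathbf a\notin\Lambda_p$. Then: 1. If $1\le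 m\le p-1$, then $\gamma_{p;(p-2)\mathbf e_0+\mathbf e_m}=\binom{p}{m+1}$. 2. If $1\le m\le p$, then $\gamma_{p;(m-1)\mathbf e_0+(p-m)\mathbf e_1}={p\brace m}$, the Stirling number of the second kind, that is, the number of partitions of a $p$-element set into exactly $m$ nonempty parts. 3. For every integer $m\ge 0$, $\displaystyle\sum_{\mathbf a\cdot\mathbf n=p-m}\gamma_{p;\mathbf a}={p\brack m}$, the signless Stirling number of the first kind, that is, the number of permutations of a $p$-element set with exactly $m$ cycles (fixed points included). 4. For every integer $m\ge 0$, $\displaystyle\sum_{\mathbf a(0)=m}\gamma_{p;\mathbf a}=\left\langle{p\atop m}\right\rangle$, the Eulerian number, that is, the number of permutations $\pi$ of $\{1,\dots,p\}$ with exactly $m$ descents (indices $i$, $1\le i<p$, with $\pi(i)>\pi(i+1)$). -/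

import Mathlib

namespace Scherk

open MvPolynomial

/-- The ring of differential polynomials over `ℤ` in two independent differential indeterminates
`f` and `g`: the variable `Sum.inl i` is the `i`-th derivative of `f`, and `Sum.inr k` is the
`k`-th derivative of `g`. -/
abbrev DiffPoly : Type := MvPolynomial (ℕ ⊕ ℕ) ℤ

/-- The derivation `D` of `DiffPoly`: it sends `f^(i)` to `f^(i+1)` and `g^(k)` to `g^(k+1)`. -/
noncomputable def D : Derivation ℤ DiffPoly DiffPoly :=
  mkDerivation ℤ (fun s : ℕ ⊕ ℕ => X (Sum.map Nat.succ Nat.succ s))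

/-- The operator `f D`. -/
noncomputable def fD (h : DiffPoly) : DiffPoly := X (Sum.inl 0) * D h

/-- `a · j`, the sum of all entries of `a`. -/
def dotJ (a : ℕ →₀ ℕ) : ℕ := a.sum (fun _ c => c)

/-- `a · n`, the sum of `i * a i` over all `i`. -/
def dotN (a : ℕ →₀ ℕ) : ℕ := a.sum (fun i c => i * c)

/-- The set `Λ_p` of all `a` with `a · j = p - 1` and `a · n < p` (for `p ≥ 1`), as a finite set;
such an `a` automatically vanishes outside `{0, …, p - 1}`, see `mem_Lam`. -/
def Lam (p : ℕ) : Finset (ℕ →₀ ℕ) :=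
  ((Finset.range p).finsuppAntidiag (p - 1)).filter (fun a => dotN a < p)

theorem mem_Lam {p : ℕ} {a : ℕ →₀ ℕ} : a ∈ Lam p ↔ dotJ a = p - 1 ∧ dotN a < p := by
  have key : dotN a < p → a.support ⊆ Finset.range p := by
    intro h i hi
    have h1 : i * a i ≤ dotN a :=
      Finset.single_le_sum (f := fun i => i * a i) (fun _ _ => Nat.zero_le _) hi
    have h2 : 1 ≤ a i := Nat.one_le_iff_ne_zero.2 (Finsupp.mem_support_iff.1 hi)
    have h3 : i ≤ i * a i := Nat.le_mul_of_pos_right i h2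
    exact Finset.mem_range.2 (by omega)
  have hs : a.support ⊆ Finset.range p → (Finset.range p).sum a = dotJ a := fun h =>
    (Finsupp.sum_of_support_subset a h (fun _ c => c) (fun _ _ => rfl)).symm
  simp only [Lam, Finset.mem_filter, Finset.mem_finsuppAntidiag]
  constructor
  · rintro ⟨⟨h1, h2⟩, h3⟩
    exact ⟨(hs h2).symm.trans h1, h3⟩
  · rintro ⟨h1, h3⟩
    exact ⟨⟨(hs (key h3)).trans h1, key h3⟩, h3⟩

/-- The coefficient `γ_{p;a}` of `f^{a + e_0} D^{p - a·n}` in the expansion of `(f D)^p` for a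
generic `f`, where `f^b` is the product of the `(f^(i))^(b i)`; it is `0` for `a ∉ Λ_p`.
The operator `∑ₖ cₖ D^k`, whose coefficients `cₖ` are differential polynomials in `f`, is read off
from its value `∑ₖ cₖ g^(k)` on the indeterminate `g`. -/
noncomputable def gamma (p : ℕ) (a : ℕ →₀ ℕ) : ℤ :=
  if a ∈ Lam p then
    coeff (Finsupp.sumElim (a + Finsupp.single 0 1) (Finsupp.single (p - dotN a) 1))
      (fD^[p] (X (Sum.inr 0)))
  else 0

/-- The number of partitions of a `p`-element set into exactly `m` (non-empty) parts. -/
noncomputable def numSetPartitions (p m : ℕ) : ℕ :=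
  Nat.card {P : Finpartition (Finset.univ : Finset (Fin p)) // P.parts.card = m}

/-- The number of permutations of a `p`-element set with exactly `m` cycles
(fixed points count as cycles). -/
noncomputable def numPermsByCycles (p m : ℕ) : ℕ :=
  Nat.card {σ : Equiv.Perm (Fin p) // σ.partition.parts.card = m}

/-- The number of descents of a permutation of `{0, …, p - 1}`. -/
noncomputable def descents {p : ℕ} (σ : Equiv.Perm (Fin p)) : ℕ :=
  Nat.card {i : Fin p // ∃ h : (i : ℕ) + 1 < p, σ ⟨(i : ℕ) + 1, h⟩ < σ i}

/-- The Eulerian number: the number of permutations of a `p`-element set with `m` descents. -/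
noncomputable def eulerian (p m : ℕ) : ℕ :=
  Nat.card {σ : Equiv.Perm (Fin p) // descents σ = m}

end Scherk

/-! Applying `fD` to a monomial `f^b g^(k)` multiplies it by `f` and, by Leibniz, raises the order
of one derivative. Hence `(fD)^p g` is a combination of the monomials indexed by `Λ_p`, each of
degree `p` in the derivatives of `f` (`iterate_fD_eq_sum`). All four claims then compare recurrences
in `p`.

The two sums over `a` come from specializations. Under `f^(i) ↦ 1`, `g^(k) ↦ X^k`, the degree
condition makes `fD` multiplication by `X + p`, the recurrence of the first-kind Stirling numbers
(`specOne_D_iterate_fD`). Under `f ↦ X` and all other variables to `1` it becomes `P ↦ X((p+1)P +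
(1-X)P')`, the Eulerian recurrence (`specX_D_iterate_fD`).

The two single coefficients come from reading Leibniz backwards (`coeff_D_fgMonomial`): each
monomial involved has at most two predecessors, which yields Pascal's rule and the second-kind
Stirling recurrence.

The combinatorial numbers satisfy the same recurrences by adding one element: to a set partition, to
a permutation's cycles, or as largest letter to a word. -/

namespace Scherk

/-! ### Set partitions and Stirling numbers of the second kind -/

/-- The map from `Option α` to the classes of `s` and possibly a new class, which sends `none`
to `o` and `some a` to the class of `a`. -/
def extendClass {α : Type*} (s : Setoid α) (o : Option (Quotient s)) : Option α → Option (Quotient s)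
  | none => o
  | some a => some (Quotient.mk s a)

open Classical in
/-- A setoid on `Option α` is a setoid on `α` together with the class, old or new, of `none`. -/
noncomputable def setoidOptionEquiv (α : Type*) :
    Setoid (Option α) ≃ Σ s : Setoid α, Option (Quotient s) where
  toFun t := ⟨t.comap some, if h : ∃ a, t none (some a) then
    some (Quotient.mk (t.comap some) h.choose) else none⟩
  invFun x := Setoid.ker (extendClass x.1 x.2)
  left_inv t := by
    -- The chosen representative is immaterial: only the class of `none` is recorded.
    have key : ∀ b, (if h : ∃ a, t none (some a) then
        some (Quotient.mk (t.comap some) h.choose) else none) = some (Quotient.mk (t.comap some) b)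
        ↔ t none (some b) := by
      intro b
      split_ifs with h
      · rw [Option.some_inj, Quotient.eq]
        exact ⟨fun hb => t.trans h.choose_spec hb, fun hb => t.trans (t.symm h.choose_spec) hb⟩
      · simp only [false_iff]
        exact fun hb => h ⟨b, hb⟩
    ext x y
    rw [Setoid.ker_def]
    cases x with
    | none =>
      cases y with
      | none => simp
      | some b => exact key b
    | some a =>
      cases y with
      | none => rw [eq_comm, t.comm']; exact key a
      | some b => simp [extendClass, Quotient.eq, Setoid.comap_rel]
  right_inv := by
    rintro ⟨s, o⟩
    have hs : (Setoid.ker (extendClass s o)).comap some = s := by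
      ext a b
      simp [extendClass, Setoid.ker_def, Quotient.eq]
    refine Sigma.ext hs ?_
    -- The type of `o` depends on the setoid. Letting `s'` vary allows substitution, after which an
    -- optional class is determined by the elements it contains.
    have key : ∀ (s' : Setoid α) (_ : s' = s) (o' : Option (Quotient s')),
        (∀ a, o' = some (Quotient.mk s' a) ↔ o = some (Quotient.mk s a)) → HEq o' o := by
      rintro s' rfl o' h
      refine heq_of_eq ?_
      rcases o with _ | q
      · rcases o' with _ | q'
        · rfl
        · induction q' using Quotient.inductionOn with
          | h a => exact ((h a).1 rfl).symm
      · induction q using Quotient.inductionOn with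
        | h a => exact (h a).2 rfl
    refine key _ hs _ fun b => ?_
    dsimp only
    split_ifs with h
    · rw [Option.some_inj, Quotient.eq, Setoid.comap_rel, Setoid.ker_def]
      have := h.choose_spec
      rw [Setoid.ker_def] at this
      rw [← this]
      rfl
    · simp only [false_iff]
      exact fun hb => h ⟨b, hb⟩

/-- Classes of a kernel correspond to the range of the map; here the range contains every old class,
and the extra point only if `none` is sent to it. -/
theorem card_quotient_setoidOptionEquiv_symm {α : Type*} [Finite α] (s : Setoid α)
    (o : Option (Quotient s)) :
    Nat.card (Quotient ((setoidOptionEquiv α).symm ⟨s, o⟩)) =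
      Nat.card (Quotient s) + if o = none then 1 else 0 := by
  have h1 : Nat.card (Quotient ((setoidOptionEquiv α).symm ⟨s, o⟩)) =
      Nat.card (Set.range (extendClass s o)) :=
    Nat.card_congr (Setoid.quotientKerEquivRange _)
  rw [h1]
  split_ifs with h
  · have : Set.range (extendClass s o) = Set.univ := by
      refine Set.eq_univ_of_forall fun q => ?_
      rcases q with _ | q
      · exact ⟨none, h⟩
      · induction q using Quotient.inductionOn with
        | h a => exact ⟨some a, rfl⟩
    rw [this, Nat.card_congr (Equiv.Set.univ _), Finite.card_option]
  · have : Set.range (extendClass s o) = Set.range (some : Quotient s → _) := by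
      ext q
      constructor
      · rintro ⟨x, rfl⟩
        rcases x with _ | a
        · obtain ⟨q, rfl⟩ := Option.ne_none_iff_exists'.1 h
          exact ⟨q, rfl⟩
        · exact ⟨_, rfl⟩
      · rintro ⟨q, rfl⟩
        induction q using Quotient.inductionOn with
        | h a => exact ⟨some a, rfl⟩
    rw [this, Nat.card_congr (Equiv.ofInjective _ (Option.some_injective _)).symm, add_zero]

theorem card_subtype_eq_sum {α : Type*} [Fintype α] (f : α → ℕ) (m : ℕ) :
    Nat.card {a // f a = m} = ∑ a, if f a = m then 1 else 0 := by
  classical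
  rw [Nat.card_eq_fintype_card, Fintype.card_subtype, Finset.card_filter]

noncomputable instance fintypeSetoid {α : Type*} [Finite α] : Fintype (Setoid α) :=
  @Fintype.ofFinite _ (Finite.of_injective (fun s : Setoid α => s.r) fun s t h => by
    ext a b; exact iff_of_eq (congrFun (congrFun h a) b))

/-- The number of equivalence relations with `m` classes. -/
noncomputable def numSetoids (α : Type*) (m : ℕ) : ℕ :=
  Nat.card {s : Setoid α // Nat.card (Quotient s) = m}

theorem numSetoids_congr {α β : Type*} (e : α ≃ β) (m : ℕ) : numSetoids α m = numSetoids β m := by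
  let E : Setoid β ≃ Setoid α :=
    { toFun := fun s => s.comap e
      invFun := fun s => s.comap e.symm
      left_inv := fun s => by ext; simp [Setoid.comap_rel]
      right_inv := fun s => by ext; simp [Setoid.comap_rel] }
  refine (Nat.card_congr (E.subtypeEquiv fun s => ?_)).symm
  rw [Nat.card_congr (Quotient.congr (rb := s) (ra := E s) e fun a b => Iff.rfl)]

/-- The new element joins one of the existing classes, keeping their number, or forms a class alone.
-/
theorem numSetoids_option {α : Type*} [Finite α] (m : ℕ) :
    numSetoids (Option α) m =
      m * numSetoids α m + Nat.card {s : Setoid α // Nat.card (Quotient s) + 1 = m} := by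
  classical
  have : ∀ s : Setoid α, Fintype (Quotient s) := fun s => Fintype.ofFinite _
  rw [numSetoids, numSetoids, Nat.card_congr ((setoidOptionEquiv α).subtypeEquiv
    (q := fun x => Nat.card (Quotient ((setoidOptionEquiv α).symm x)) = m) fun t => by simp),
    card_subtype_eq_sum, Fintype.sum_sigma, card_subtype_eq_sum, card_subtype_eq_sum,
    Finset.mul_sum, ← Finset.sum_add_distrib]
  refine Finset.sum_congr rfl fun s _ => ?_
  rw [Fintype.sum_option, add_comm]
  simp only [card_quotient_setoidOptionEquiv_symm]
  simp only [reduceCtorEq, if_false, if_true, add_zero]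
  congr 1
  rw [Finset.sum_const, Finset.card_univ, ← Nat.card_eq_fintype_card, smul_eq_mul]
  split_ifs with h
  · rw [h]
  · simp

theorem numSetoids_fin (n m : ℕ) : numSetoids (Fin n) m = Nat.stirlingSecond n m := by
  induction n generalizing m with
  | zero =>
    have : ∀ s : Setoid (Fin 0), Nat.card (Quotient s) = 0 := fun s => by
      rw [Nat.card_eq_zero]; left
      exact ⟨fun q => Quotient.inductionOn q fun a => a.elim0⟩
    rw [numSetoids, card_subtype_eq_sum]
    simp only [this]
    have hc : Fintype.card (Setoid (Fin 0)) = 1 := by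
      rw [Fintype.card_eq_one_iff]
      exact ⟨⊤, fun s => by ext a; exact a.elim0⟩
    cases m with
    | zero => simp [hc]
    | succ m => simp
  | succ n ih =>
    rw [numSetoids_congr (finSuccEquiv n), numSetoids_option, ih]
    cases m with
    | zero => simp
    | succ m =>
      rw [Nat.stirlingSecond_succ_succ, ← ih m, numSetoids]
      simp only [Nat.add_right_cancel_iff]

open Classical in
/-- Partitions of a finite type are the same as equivalence relations. -/
noncomputable def finpartitionEquivSetoid (α : Type*) [Fintype α] [DecidableEq α] :
    Finpartition (Finset.univ : Finset α) ≃ Setoid α where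
  toFun P := Setoid.ker P.part
  invFun s := Finpartition.ofSetoid s
  left_inv P := by
    have hpart : ∀ a, (Finpartition.ofSetoid (Setoid.ker P.part)).part a = P.part a := by
      intro a
      ext b
      rw [Finpartition.mem_part_ofSetoid_iff_rel, Setoid.ker_def,
        P.mem_part_iff_part_eq_part (Finset.mem_univ _) (Finset.mem_univ _), eq_comm]
    have parts_eq : ∀ Q : Finpartition (Finset.univ : Finset α),
        Q.parts = Finset.univ.image Q.part := by
      intro Q
      ext t
      simp only [Finset.mem_image, Finset.mem_univ, true_and]
      constructor
      · intro ht
        obtain ⟨a, ha⟩ := Q.nonempty_of_mem_parts ht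
        exact ⟨a, Q.part_eq_of_mem ht ha⟩
      · rintro ⟨a, rfl⟩
        exact Q.part_mem.2 (Finset.mem_univ a)
    refine Finpartition.ext ?_
    rw [parts_eq, parts_eq P]
    exact Finset.image_congr fun a _ => hpart a
  right_inv s := by
    ext a b
    rw [Setoid.ker_def, ← Finpartition.mem_part_iff_part_eq_part _ (Finset.mem_univ _)
      (Finset.mem_univ _), Finpartition.mem_part_ofSetoid_iff_rel]
    exact s.comm'

theorem card_quotient_finpartitionEquivSetoid {α : Type*} [Fintype α] [DecidableEq α]
    (P : Finpartition (Finset.univ : Finset α)) :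
    Nat.card (Quotient (finpartitionEquivSetoid α P)) = P.parts.card := by
  classical
  have h1 : Nat.card (Quotient (finpartitionEquivSetoid α P)) = Nat.card (Set.range P.part) := by
    exact Nat.card_congr (Setoid.quotientKerEquivRange _)
  have h2 : Set.range P.part = P.parts := by
    ext t
    constructor
    · rintro ⟨a, rfl⟩
      exact P.part_mem.2 (Finset.mem_univ a)
    · intro ht
      obtain ⟨a, ha⟩ := P.nonempty_of_mem_parts ht
      exact ⟨a, P.part_eq_of_mem ht ha⟩
  rw [h1, h2]
  simp

theorem numSetPartitions_eq_stirlingSecond (p m : ℕ) :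
    numSetPartitions p m = Nat.stirlingSecond p m := by
  rw [← numSetoids_fin, numSetPartitions, numSetoids]
  exact Nat.card_congr ((finpartitionEquivSetoid (Fin p)).subtypeEquiv fun P => by
    rw [card_quotient_finpartitionEquivSetoid])

/-! ### Cycles of permutations and Stirling numbers of the first kind -/

open Equiv

/-- Orbits are easier to follow under insertion of a point than cycle types. The map `f` treats
fixed points separately because `cycleOf` is the identity at each of them and would merge them all.
-/
theorem card_quotient_sameCycle {α : Type*} [Fintype α] [DecidableEq α] (σ : Perm α) :
    Nat.card (Quotient (Perm.SameCycle.setoid σ)) = σ.partition.parts.card := by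
  let f : α → Perm α ⊕ α := fun x => if σ x = x then Sum.inr x else Sum.inl (σ.cycleOf x)
  have hker : Perm.SameCycle.setoid σ = Setoid.ker f := by
    ext x y
    rw [Setoid.ker_def]
    change σ.SameCycle x y ↔ _
    by_cases hx : σ x = x
    · by_cases hy : σ y = y
      · simp only [f, hx, hy, if_true, Sum.inr.injEq]
        exact ⟨fun h => h.eq_of_left hx, fun h => h ▸ Perm.SameCycle.refl _ _⟩
      · simp only [f, hx, hy, if_true, if_false, reduceCtorEq, iff_false]
        exact fun h => hy (h.apply_eq_self_iff.1 hx)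
    · by_cases hy : σ y = y
      · simp only [f, hx, hy, if_true, if_false, reduceCtorEq, iff_false]
        exact fun h => hx (h.apply_eq_self_iff.2 hy)
      · simp only [f, hx, hy, if_false, Sum.inl.injEq]
        refine ⟨fun h => h.cycleOf_eq, fun h => ?_⟩
        have : y ∈ (σ.cycleOf x).support := by
          rw [h, Perm.mem_support, Perm.cycleOf_apply_self]; exact hy
        exact (Perm.mem_support_cycleOf_iff.1 this).1
  have hrange : Set.range f = ((σ.cycleFactorsFinset.disjSum σ.supportᶜ : Finset _) : Set _) := by
    ext z
    simp only [Set.mem_range, Finset.mem_coe, Finset.mem_disjSum, Finset.mem_compl,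
      Perm.mem_support, not_not, f]
    constructor
    · rintro ⟨x, rfl⟩
      split_ifs with h
      · exact Or.inr ⟨x, h, rfl⟩
      · exact Or.inl ⟨_, Perm.cycleOf_mem_cycleFactorsFinset_iff.2 (Perm.mem_support.2 h), rfl⟩
    · rintro (⟨c, hc, rfl⟩ | ⟨x, hx, rfl⟩)
      · have hcyc := (Perm.mem_cycleFactorsFinset_iff.1 hc).1
        obtain ⟨x, hx⟩ := hcyc.nonempty_support
        refine ⟨x, ?_⟩
        have hxσ := Perm.mem_cycleFactorsFinset_support_le hc hx
        rw [if_neg (Perm.mem_support.1 hxσ), ← Perm.cycle_is_cycleOf hx hc]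
      · exact ⟨x, if_pos hx⟩
  rw [hker, Nat.card_congr (Setoid.quotientKerEquivRange f), hrange, Perm.parts_partition,
    Multiset.card_add, Multiset.card_replicate, Perm.cycleType_def, Multiset.card_map]
  simp [Finset.card_compl]

/-- For `o = none` the new point is fixed and forms its own cycle; for `o = some x` it is spliced
into the cycle of `x`, just before `x`. -/
theorem card_parts_decomposeOption_symm {α : Type*} [Fintype α] [DecidableEq α] (o : Option α)
    (e : Perm α) :
    (Perm.decomposeOption.symm (o, e)).partition.parts.card =
      e.partition.parts.card + if o = none then 1 else 0 := by
  rw [← card_quotient_sameCycle, ← card_quotient_sameCycle]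
  set σ := Perm.decomposeOption.symm (o, e) with hσ
  rcases o with _ | x
  · have hs : ∀ a, σ (some a) = some (e a) := fun a => by simp [hσ]
    have hn : σ none = none := by simp [hσ]
    have hz : ∀ (k : ℤ) a, (σ ^ k) (some a) = some ((e ^ k) a) := by
      intro k
      induction k using Int.induction_on with
      | zero => exact fun a => rfl
      | succ k ih => intro a; rw [zpow_add_one, zpow_add_one, Perm.mul_apply, hs, ih]; rfl
      | pred k ih =>
        intro a
        have hi : σ⁻¹ (some a) = some (e⁻¹ a) := by rw [Perm.inv_eq_iff_eq, hs]; simp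
        rw [zpow_sub_one, zpow_sub_one, Perm.mul_apply, hi, ih]; rfl
    rw [if_pos rfl, ← Finite.card_option]
    let f : Option α → Option (Quotient (Perm.SameCycle.setoid e)) := Option.map (Quotient.mk _)
    have hker : Perm.SameCycle.setoid σ = Setoid.ker f := by
      ext u v
      rw [Setoid.ker_def]
      change σ.SameCycle u v ↔ _
      rcases u with _ | a <;> rcases v with _ | b
      · simp [f, Perm.SameCycle.refl]
      · simp only [f, Option.map_none, Option.map_some, reduceCtorEq, iff_false]
        intro h; have := h.eq_of_left hn; simp at this
      · simp only [f, Option.map_none, Option.map_some, reduceCtorEq, iff_false]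
        intro h; have := h.eq_of_right hn; simp at this
      · simp only [f, Option.map_some, Option.some_inj, Quotient.eq]
        change _ ↔ e.SameCycle a b
        simp only [Perm.SameCycle, hz, Option.some_inj]
    rw [hker]
    refine Nat.card_congr (Setoid.quotientKerEquivOfSurjective f fun q => ?_)
    rcases q with _ | q
    · exact ⟨none, rfl⟩
    · induction q using Quotient.inductionOn with
      | h a => exact ⟨some a, rfl⟩
  · have hn : σ none = some x := by simp [hσ]
    have hs : ∀ a, σ (some a) = if e a = x then none else some (e a) := by
      intro a
      by_cases h : e a = x <;> simp [hσ, h, Equiv.swap_apply_def]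
    -- One step of `e` is one step of `σ`, or two when the path passes through `none`.
    have step : ∀ a, σ.SameCycle (some a) (some (e a)) := by
      intro a
      by_cases h : e a = x
      · refine ⟨2, ?_⟩
        rw [show (2 : ℤ) = 1 + 1 from rfl, zpow_add, zpow_one, Perm.mul_apply, hs, if_pos h, hn, h]
      · exact ⟨1, by rw [zpow_one, hs, if_neg h]⟩
    have fwd : ∀ a b, e.SameCycle a b → σ.SameCycle (some a) (some b) := by
      rintro a b ⟨k, rfl⟩
      induction k using Int.induction_on with
      | zero => exact Perm.SameCycle.refl _ _
      | succ k ih =>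
        rw [add_comm, zpow_add, zpow_one, Perm.mul_apply]
        exact ih.trans (step _)
      | pred k ih =>
        refine ih.trans ?_
        have := step ((e ^ (-(k : ℤ) - 1)) a)
        rw [← Perm.mul_apply, ← zpow_one_add] at this
        ring_nf at this ⊢
        exact this.symm
    -- Contracting `none` onto `x` turns a step of `σ` into at most one step of `e`, giving the
    -- inverse map on orbits.
    let r : Option α → α := fun u => u.getD x
    have rstep : ∀ u, e.SameCycle (r u) (r (σ u)) := by
      rintro (_ | a)
      · rw [hn]; exact Perm.SameCycle.refl _ _
      · rw [hs]
        split_ifs with h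
        · exact ⟨1, by simpa [r] using h⟩
        · exact ⟨1, by simp [r]⟩
    have bwd : ∀ u v, σ.SameCycle u v → e.SameCycle (r u) (r v) := by
      rintro u v ⟨k, rfl⟩
      induction k using Int.induction_on with
      | zero => exact Perm.SameCycle.refl _ _
      | succ k ih =>
        rw [add_comm, zpow_add, zpow_one, Perm.mul_apply]
        exact ih.trans (rstep _)
      | pred k ih =>
        refine ih.trans ?_
        have := rstep ((σ ^ (-(k : ℤ) - 1)) u)
        rw [← Perm.mul_apply, ← zpow_one_add] at this
        ring_nf at this ⊢
        exact this.symm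
    rw [if_neg (by simp), add_zero]
    refine (Nat.card_congr ⟨Quotient.map some fwd, Quotient.map r bwd, ?_, ?_⟩).symm
    · intro q
      induction q using Quotient.inductionOn with
      | h a => rfl
    · intro q
      induction q using Quotient.inductionOn with
      | h u =>
        rcases u with _ | a
        · exact Quotient.sound (⟨-1, by simp [← hn]⟩ : σ.SameCycle (some x) none)
        · rfl

/-- The number of permutations of `α` with `m` cycles. -/
noncomputable def numPermsOfCycles (α : Type*) [Fintype α] [DecidableEq α] (m : ℕ) : ℕ :=
  Nat.card {σ : Perm α // σ.partition.parts.card = m}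

theorem numPermsOfCycles_congr {α β : Type*} [Fintype α] [DecidableEq α] [Fintype β]
    [DecidableEq β] (e : α ≃ β) (m : ℕ) : numPermsOfCycles α m = numPermsOfCycles β m := by
  refine Nat.card_congr (e.permCongr.subtypeEquiv fun σ => ?_)
  rw [← card_quotient_sameCycle, ← card_quotient_sameCycle,
    Nat.card_congr (Quotient.congr (ra := Perm.SameCycle.setoid σ)
      (rb := Perm.SameCycle.setoid (e.permCongr σ)) e fun a b => ?_)]
  change σ.SameCycle a b ↔ (e.permCongr σ).SameCycle (e a) (e b)
  have : ∀ k : ℤ, (e.permCongr σ) ^ k = e.permCongr (σ ^ k) := fun k =>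
    (map_zpow e.permCongrHom σ k).symm
  simp [Perm.SameCycle, this]

theorem numPermsOfCycles_option {α : Type*} [Fintype α] [DecidableEq α] (m : ℕ) :
    numPermsOfCycles (Option α) m = Nat.card α * numPermsOfCycles α m +
      Nat.card {σ : Perm α // σ.partition.parts.card + 1 = m} := by
  rw [numPermsOfCycles, numPermsOfCycles, Nat.card_congr (Perm.decomposeOption.subtypeEquiv
    (q := fun x : Option α × Perm α => (Perm.decomposeOption.symm x).partition.parts.card = m)
      fun t => by simp),
    card_subtype_eq_sum, Fintype.sum_prod_type_right, card_subtype_eq_sum, card_subtype_eq_sum,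
    Finset.mul_sum, ← Finset.sum_add_distrib]
  refine Finset.sum_congr rfl fun s _ => ?_
  rw [Fintype.sum_option, add_comm]
  simp only [card_parts_decomposeOption_symm]
  simp only [reduceCtorEq, if_false, if_true, add_zero]
  simp

theorem numPermsByCycles_eq_stirlingFirst (p m : ℕ) :
    numPermsByCycles p m = Nat.stirlingFirst p m := by
  change numPermsOfCycles (Fin p) m = _
  induction p generalizing m with
  | zero =>
    have : ∀ σ : Perm (Fin 0), σ.partition.parts.card = 0 := fun s => by
      rw [← card_quotient_sameCycle, Nat.card_eq_zero]; left
      exact ⟨fun q => Quotient.inductionOn q fun a => a.elim0⟩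
    rw [numPermsOfCycles, card_subtype_eq_sum]
    simp only [this]
    cases m with
    | zero => simp
    | succ m => simp
  | succ n ih =>
    rw [numPermsOfCycles_congr (finSuccEquiv n), numPermsOfCycles_option, ih, Nat.card_fin]
    cases m with
    | zero => cases n <;> simp
    | succ m =>
      rw [Nat.stirlingFirst_succ_succ, ← ih m, numPermsOfCycles]
      simp only [Nat.add_right_cancel_iff]

/-! ### Descents and the Eulerian recurrence -/

/-- The number of descents among the first `p` letters of a word. -/
def descCount (w : ℕ → ℕ) (p : ℕ) : ℕ :=
  ∑ k ∈ Finset.range (p - 1), if w (k + 1) < w k then 1 else 0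

theorem descCount_congr {w v : ℕ → ℕ} {p : ℕ} (h : ∀ k < p, w k = v k) :
    descCount w p = descCount v p := by
  refine Finset.sum_congr rfl fun k hk => ?_
  rw [Finset.mem_range] at hk
  rw [h k (by omega), h (k + 1) (by omega)]

/-- Insert the letter `M` into the word `w` at position `i`. -/
def insertLetter (w : ℕ → ℕ) (i M k : ℕ) : ℕ :=
  if k < i then w k else if k = i then M else w (k - 1)

/-- A maximal letter at the end creates no descent; inside a descent it replaces that descent by
another; anywhere else it creates one. The induction lengthens the word past the insertion point,
where the letters are only shifted. -/
theorem descCount_insertLetter {w : ℕ → ℕ} {i M p : ℕ} (hip : i ≤ p) (hw : ∀ k < p, w k < M) :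
    descCount (insertLetter w i M) (p + 1) =
      descCount w p + if i = p ∨ 1 ≤ i ∧ w i < w (i - 1) then 0 else 1 := by
  induction p, hip using Nat.le_induction with
  | base =>
    rw [if_pos (Or.inl rfl), add_zero]
    rcases i with _ | i
    · rfl
    · rw [descCount, descCount, Nat.add_sub_cancel, Nat.add_sub_cancel, Finset.sum_range_succ,
        if_neg, add_zero]
      · refine Finset.sum_congr rfl fun k hk => ?_
        rw [Finset.mem_range] at hk
        simp [insertLetter, show k < i + 1 by omega, hk]
      · have := hw i (by omega)
        simp [insertLetter]
        omega
  | succ p hip ih =>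
    have ih := ih fun k hk => hw k (by omega)
    have h1 : descCount (insertLetter w i M) (p + 1 + 1) = descCount (insertLetter w i M) (p + 1) +
        if insertLetter w i M (p + 1) < insertLetter w i M p then 1 else 0 :=
      Finset.sum_range_succ _ _
    have h2 : descCount w (p + 1) = descCount w p + if 1 ≤ p ∧ w p < w (p - 1) then 1 else 0 := by
      rcases p with _ | p
      · rfl
      · rw [descCount, descCount, Nat.add_sub_cancel, Nat.add_sub_cancel, Finset.sum_range_succ]
        simp
    rw [h1, ih, h2]
    have hp := hw p (by omega)
    rcases hip.eq_or_lt with rfl | hlt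
    · simp only [insertLetter]
      simp [hp]
      split_ifs <;> rfl
    · have e1 : insertLetter w i M (p + 1) = w p := by
        simp [insertLetter, show ¬ p + 1 < i by omega, show p + 1 ≠ i by omega]
      have e2 : insertLetter w i M p = w (p - 1) := by
        simp [insertLetter, show ¬ p < i by omega, show p ≠ i by omega]
      rw [e1, e2]
      simp only [show i ≠ p by omega, show i ≠ p + 1 by omega, false_or, show 1 ≤ p by omega,
        true_and]
      omega

theorem sum_insertion_positions (w : ℕ → ℕ) (p : ℕ) :
    (∑ i ∈ Finset.range (p + 1), if i = p ∨ 1 ≤ i ∧ w i < w (i - 1) then 1 else 0) =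
      descCount w p + 1 := by
  rw [Finset.sum_range_succ, if_pos (Or.inl rfl)]
  congr 1
  have : ∀ i ∈ Finset.range p, (if i = p ∨ 1 ≤ i ∧ w i < w (i - 1) then 1 else 0) =
      if 1 ≤ i ∧ w i < w (i - 1) then 1 else 0 := by
    intro i hi
    simp [(Finset.mem_range.1 hi).ne]
  rw [Finset.sum_congr rfl this]
  rcases p with _ | p
  · rfl
  · rw [Finset.sum_range_succ', descCount]
    simp

/-- The word of a permutation. -/
def word {p : ℕ} (σ : Perm (Fin p)) (k : ℕ) : ℕ := if h : k < p then σ ⟨k, h⟩ else 0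

theorem descents_eq_descCount {p : ℕ} (σ : Perm (Fin p)) :
    descents σ = descCount (word σ) p := by
  classical
  rw [descents, Nat.card_eq_fintype_card, Fintype.card_subtype, Finset.card_filter]
  rcases p with _ | p
  · rfl
  -- The last position has no successor and contributes nothing.
  · rw [Fin.sum_univ_castSucc, if_neg (by simp), add_zero, descCount, Nat.add_sub_cancel,
      ← Fin.sum_univ_eq_sum_range (fun k => if word σ (k + 1) < word σ k then 1 else 0)]
    refine Finset.sum_congr rfl fun k _ => ?_
    have h1 : (k : ℕ) + 1 < p + 1 := by omega
    have h2 : (k : ℕ) < p + 1 := by omega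
    simp only [word, dif_pos h1, dif_pos h2, Fin.val_castSucc, Fin.lt_def, exists_prop_of_true h1]
    rfl

/-- Insert the largest letter into the word of a permutation at position `i`. -/
def insertMax {p : ℕ} (x : Fin (p + 1) × Perm (Fin p)) : Perm (Fin (p + 1)) :=
  (finSuccEquiv' x.1).trans (x.2.optionCongr.trans (finSuccEquiv' (Fin.last p)).symm)

theorem insertMax_self {p : ℕ} (i : Fin (p + 1)) (σ : Perm (Fin p)) :
    insertMax (i, σ) i = Fin.last p := by
  simp [insertMax]

theorem insertMax_succAbove {p : ℕ} (i : Fin (p + 1)) (σ : Perm (Fin p)) (j : Fin p) :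
    insertMax (i, σ) (i.succAbove j) = (σ j).castSucc := by
  simp [insertMax]

theorem insertMax_bijective (p : ℕ) : Function.Bijective (insertMax (p := p)) := by
  rw [Fintype.bijective_iff_injective_and_card]
  constructor
  · rintro ⟨i, σ⟩ ⟨j, τ⟩ h
    have hij : i = j := by
      apply (insertMax (j, τ)).injective
      rw [insertMax_self, ← h, insertMax_self]
    subst hij
    congr 1
    ext k
    have := insertMax_succAbove i σ k
    rw [h, insertMax_succAbove] at this
    exact congrArg Fin.val (Fin.castSucc_injective _ this).symm
  · simp [Fintype.card_perm, Nat.factorial_succ]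

theorem word_insertMax {p : ℕ} (i : Fin (p + 1)) (σ : Perm (Fin p)) {k : ℕ} (hk : k < p + 1) :
    word (insertMax (i, σ)) k = insertLetter (word σ) i p k := by
  rw [word, dif_pos hk, insertLetter]
  rcases lt_trichotomy k i with h | h | h
  · have hkp : k < p := by omega
    rw [if_pos h, word, dif_pos hkp]
    have : (⟨k, hk⟩ : Fin (p + 1)) = i.succAbove ⟨k, hkp⟩ := by
      rw [Fin.succAbove_of_castSucc_lt _ _ (by simpa [Fin.lt_def] using h)]; rfl
    rw [this, insertMax_succAbove]; rfl
  · rw [if_neg (by omega), if_pos h, show (⟨k, hk⟩ : Fin (p + 1)) = i from Fin.ext h,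
      insertMax_self]; rfl
  · have hkp : k - 1 < p := by omega
    rw [if_neg (by omega), if_neg (by omega), word, dif_pos hkp]
    have : (⟨k, hk⟩ : Fin (p + 1)) = i.succAbove ⟨k - 1, hkp⟩ := by
      rw [Fin.succAbove_of_le_castSucc _ _ (by simp [Fin.le_def]; omega)]
      ext; simp; omega
    rw [this, insertMax_succAbove]; rfl

/-- Of the `p + 1` positions, `descents σ + 1` preserve the number of descents (the end and the
existing descents), and the other `p - descents σ` raise it by one. -/
theorem sum_insertMax {p : ℕ} (σ : Perm (Fin p)) (m : ℕ) :
    (∑ i : Fin (p + 1), if descents (insertMax (i, σ)) = m then (1 : ℤ) else 0) =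
      (if descents σ = m then (descents σ : ℤ) + 1 else 0) +
        if descents σ + 1 = m then (p : ℤ) - descents σ else 0 := by
  have hw : ∀ k < p, word σ k < p := fun k hk => by rw [word, dif_pos hk]; exact Fin.is_lt _
  have h1 : ∀ i : Fin (p + 1), descents (insertMax (i, σ)) = descents σ +
      if (i : ℕ) = p ∨ 1 ≤ (i : ℕ) ∧ word σ i < word σ (i - 1) then 0 else 1 := fun i => by
    rw [descents_eq_descCount, descents_eq_descCount,
      descCount_congr fun k hk => word_insertMax i σ hk,
      descCount_insertLetter (Nat.lt_succ_iff.1 i.2) hw]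
  have h2 := sum_insertion_positions (word σ) p
  rw [← Fin.sum_univ_eq_sum_range
    (fun i => if i = p ∨ 1 ≤ i ∧ word σ i < word σ (i - 1) then 1 else 0),
    ← descents_eq_descCount] at h2
  simp only [h1]
  generalize descents σ = d at *
  -- Writing the summand as an affine function of the indicator of a preserving position reduces the
  -- sum to the count `h2`.
  have h3 : ∀ i : Fin (p + 1), (if (d + if (i : ℕ) = p ∨ 1 ≤ (i : ℕ) ∧ word σ i < word σ (i - 1)
      then 0 else 1) = m then (1 : ℤ) else 0) = (if d + 1 = m then 1 else 0) +
        ((if d = m then 1 else 0) - if d + 1 = m then 1 else 0) *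
        ((if (i : ℕ) = p ∨ 1 ≤ (i : ℕ) ∧ word σ i < word σ (i - 1) then 1 else 0 : ℕ) : ℤ) := by
    intro i
    by_cases h : (i : ℕ) = p ∨ 1 ≤ (i : ℕ) ∧ word σ i < word σ (i - 1)
    · rw [if_pos h, if_pos h]; simp
    · rw [if_neg h, if_neg h]; simp
  rw [Finset.sum_congr rfl fun i _ => h3 i, Finset.sum_add_distrib, ← Finset.mul_sum,
    ← Nat.cast_sum, h2, Finset.sum_const, Finset.card_univ, Fintype.card_fin]
  split_ifs <;> simp <;> ring

theorem eulerian_succ_eq_sum (p m : ℕ) : (eulerian (p + 1) m : ℤ) = ∑ σ : Perm (Fin p),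
    ((if descents σ = m then (descents σ : ℤ) + 1 else 0) +
        if descents σ + 1 = m then (p : ℤ) - descents σ else 0) := by
  rw [eulerian, card_subtype_eq_sum, ← (insertMax_bijective p).sum_comp,
    Fintype.sum_prod_type_right, Nat.cast_sum]
  refine Finset.sum_congr rfl fun σ _ => ?_
  rw [← sum_insertMax]
  push_cast
  rfl

theorem eulerian_succ_zero (p : ℕ) : (eulerian (p + 1) 0 : ℤ) = eulerian p 0 := by
  rw [eulerian_succ_eq_sum, eulerian, card_subtype_eq_sum, Nat.cast_sum]
  refine Finset.sum_congr rfl fun σ _ => ?_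
  split_ifs <;> simp_all

theorem eulerian_succ_succ (p m : ℕ) : (eulerian (p + 1) (m + 1) : ℤ) =
    (m + 2) * eulerian p (m + 1) + (p - m) * eulerian p m := by
  rw [eulerian_succ_eq_sum, eulerian, eulerian, card_subtype_eq_sum, card_subtype_eq_sum,
    Nat.cast_sum, Nat.cast_sum, Finset.mul_sum, Finset.mul_sum, ← Finset.sum_add_distrib]
  refine Finset.sum_congr rfl fun σ _ => ?_
  simp only [Nat.add_right_cancel_iff]
  by_cases h1 : descents σ = m + 1
  · simp [h1]; ring
  · by_cases h2 : descents σ = m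
    · simp [h2]
    · simp [h1, h2]

theorem eulerian_zero (m : ℕ) : eulerian 0 m = if m = 0 then 1 else 0 := by
  rw [eulerian, card_subtype_eq_sum]
  simp [descents, eq_comm]

/-! ### The expansion of `(fD)^p` into monomials -/

open MvPolynomial

/-- The monomial `f^b g^(k)`. -/
noncomputable def fgMonomial (b : ℕ →₀ ℕ) (k : ℕ) : DiffPoly :=
  monomial (Finsupp.sumElim b (Finsupp.single k 1)) 1

theorem D_fgMonomial (b : ℕ →₀ ℕ) (k : ℕ) :
    D (fgMonomial b k) = fgMonomial b (k + 1) +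
      ∑ i ∈ b.support, (b i : ℤ) •
        fgMonomial (b - Finsupp.single i 1 + Finsupp.single (i + 1) 1) k := by
  rw [D, fgMonomial, mkDerivation_monomial, one_smul, Finsupp.sum_sumElim, add_comm]
  congr 1
  · rw [Finsupp.sum_single_index (by simp)]
    simp only [Function.comp_apply, Sum.map_inr, smul_eq_mul, X, monomial_mul, fgMonomial,
      Nat.cast_one, mul_one]
    refine congrArg (fun s => monomial s (1 : ℤ)) ?_
    ext (j | j) <;> simp [Finsupp.single_apply]
  · refine Finset.sum_congr rfl fun i hi => ?_
    have hbi : b i ≠ 0 := Finsupp.mem_support_iff.1 hi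
    simp only [Function.comp_apply, Sum.map_inl, smul_eq_mul, X, monomial_mul, fgMonomial,
      smul_monomial, mul_one]
    refine congrArg (fun s => monomial s (b i : ℤ)) ?_
    ext (j | j) <;> simp [Finsupp.single_apply]

theorem X_mul_fgMonomial (b : ℕ →₀ ℕ) (k : ℕ) :
    X (Sum.inl 0) * fgMonomial b k = fgMonomial (b + Finsupp.single 0 1) k := by
  rw [fgMonomial, fgMonomial, X, monomial_mul, one_mul]
  refine congrArg (fun s => monomial s (1 : ℤ)) ?_
  ext (j | j) <;> simp [Finsupp.single_apply, add_comm]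

theorem dotN_add (a b : ℕ →₀ ℕ) : dotN (a + b) = dotN a + dotN b :=
  Finsupp.sum_add_index' (by simp) fun _ _ _ => mul_add _ _ _

theorem dotJ_add (a b : ℕ →₀ ℕ) : dotJ (a + b) = dotJ a + dotJ b :=
  Finsupp.sum_add_index' (by simp) fun _ _ _ => rfl

theorem dotN_single (i c : ℕ) : dotN (Finsupp.single i c) = i * c :=
  Finsupp.sum_single_index (by simp)

theorem dotJ_single (i c : ℕ) : dotJ (Finsupp.single i c) = c :=
  Finsupp.sum_single_index rfl

/-- The monomial with coefficient `γ_{p;a}` in the expansion of `(f D)^p`. -/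
noncomputable def expansionMonomial (p : ℕ) (a : ℕ →₀ ℕ) : DiffPoly :=
  fgMonomial (a + Finsupp.single 0 1) (p - dotN a)

/-- Differentiating `g` keeps `a · n` and raises the order of `g`; differentiating a factor `f^(i)`
raises `a · n` by one and keeps that order. Either way the index lands in the next `Λ`. -/
theorem iterate_fD_mem_span {p : ℕ} (hp : 1 ≤ p) :
    fD^[p] (X (Sum.inr 0)) ∈ Submodule.span ℤ (expansionMonomial p '' (Lam p : Set (ℕ →₀ ℕ))) := by
  induction p, hp using Nat.le_induction with
  | base =>
    refine Submodule.subset_span ⟨0, ?_, ?_⟩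
    · simp [mem_Lam, dotJ, dotN]
    · rw [Function.iterate_one, fD, D, mkDerivation_X]
      simp only [expansionMonomial, fgMonomial, X, Sum.map_inr, monomial_mul, mul_one]
      refine congrArg (fun s => monomial s (1 : ℤ)) ?_
      ext (j | j) <;> simp [Finsupp.single_apply, dotN]
  | succ p hp ih =>
    rw [Function.iterate_succ_apply']
    refine Submodule.span_induction (p := fun x _ => fD x ∈ Submodule.span ℤ
      (expansionMonomial (p + 1) '' (Lam (p + 1) : Set (ℕ →₀ ℕ)))) ?_ ?_ ?_ ?_ ih
    rotate_left
    · simp [fD]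
    · intro x y _ _ hx hy
      rw [fD, map_add, mul_add]
      exact add_mem hx hy
    · intro c x _ hx
      rw [fD, D.map_smul, mul_smul_comm]
      exact Submodule.smul_mem _ c hx
    rintro _ ⟨a, ha, rfl⟩
    obtain ⟨h1, h2⟩ := mem_Lam.1 ha
    rw [fD]
    rw [expansionMonomial, D_fgMonomial, mul_add, Finset.mul_sum, X_mul_fgMonomial]
    refine add_mem (Submodule.subset_span ⟨a + Finsupp.single 0 1, ?_, ?_⟩)
      (Submodule.sum_mem _ fun i hi => ?_)
    · refine mem_Lam.2 ⟨?_, ?_⟩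
      · rw [dotJ_add, dotJ_single]; omega
      · rw [dotN_add, dotN_single]; omega
    · rw [expansionMonomial, dotN_add, dotN_single]
      congr 1
      omega
    · rw [mul_smul_comm, X_mul_fgMonomial]
      refine Submodule.smul_mem _ _ (Submodule.subset_span ?_)
      set b := a + Finsupp.single 0 1 with hb
      -- Since `i` is in the support the truncated subtraction is exact, so the two weights follow
      -- by additivity.
      have hbi : b - Finsupp.single i 1 + Finsupp.single i 1 = b :=
        tsub_add_cancel_of_le (Finsupp.single_le_iff.2
          (Nat.one_le_iff_ne_zero.2 (Finsupp.mem_support_iff.1 hi)))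
      have hJ := congrArg dotJ hbi
      have hN := congrArg dotN hbi
      rw [dotJ_add, dotJ_single, hb, dotJ_add, dotJ_single, ← hb] at hJ
      rw [dotN_add, dotN_single, hb, dotN_add, dotN_single, ← hb] at hN
      refine ⟨b - Finsupp.single i 1 + Finsupp.single (i + 1) 1, mem_Lam.2 ⟨?_, ?_⟩, ?_⟩
      · rw [dotJ_add, dotJ_single]; omega
      · rw [dotN_add, dotN_single]; omega
      · rw [expansionMonomial, dotN_add, dotN_single]
        congr 1
        omega

theorem coeff_expansionMonomial (p : ℕ) (a b : ℕ →₀ ℕ) :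
    coeff (Finsupp.sumElim (b + Finsupp.single 0 1) (Finsupp.single (p - dotN b) 1))
      (expansionMonomial p a) = if a = b then 1 else 0 := by
  rw [expansionMonomial, fgMonomial, coeff_monomial]
  refine if_congr ⟨fun h => ?_, fun h => by rw [h]⟩ rfl rfl
  ext i
  have := DFunLike.congr_fun h (Sum.inl i)
  simpa using this

/-- The expansion of `(f D)^p`. -/
theorem iterate_fD_eq_sum {p : ℕ} (hp : 1 ≤ p) :
    fD^[p] (X (Sum.inr 0)) = ∑ a ∈ Lam p, gamma p a • expansionMonomial p a := by
  obtain ⟨c, hc⟩ := (Submodule.mem_span_image_finset_iff_exists_fun' ℤ).1 (iterate_fD_mem_span hp)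
  rw [← hc]
  refine Finset.sum_congr rfl fun a ha => ?_
  rw [gamma, if_pos ha, ← hc, coeff_sum]
  simp only [coeff_smul, coeff_expansionMonomial, smul_eq_mul, mul_ite, mul_one, mul_zero,
    Finset.sum_ite_eq', ha, if_true]

/-- Since `a · n < p`, `g` is differentiated at least once. This is the boundary case of the
coefficient recurrences. -/
theorem coeff_iterate_fD_eq_zero {p : ℕ} (hp : 1 ≤ p) (b : ℕ →₀ ℕ) :
    coeff (Finsupp.sumElim b (Finsupp.single 0 1)) (fD^[p] (X (Sum.inr 0))) = 0 := by
  rw [iterate_fD_eq_sum hp, coeff_sum]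
  refine Finset.sum_eq_zero fun a ha => ?_
  rw [coeff_smul, expansionMonomial, fgMonomial, coeff_monomial, if_neg, smul_zero]
  intro h
  have := DFunLike.congr_fun h (Sum.inr 0)
  have h2 := (mem_Lam.1 ha).2
  simp [Finsupp.single_apply] at this
  omega

/-- A property of linear nature holds for `(f D)^p g` if it holds for all monomials
`f^b g^(k)` with `b · j = p`. -/
theorem iterate_fD_induction {p : ℕ} (hp : 1 ≤ p) (C : DiffPoly → Prop) (zero : C 0)
    (add : ∀ x y, C x → C y → C (x + y)) (smul : ∀ (c : ℤ) x, C x → C (c • x))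
    (mon : ∀ b k, dotJ b = p → C (fgMonomial b k)) : C (fD^[p] (X (Sum.inr 0))) := by
  rw [iterate_fD_eq_sum hp]
  refine Finset.sum_induction _ C add zero fun a ha => smul _ _ (mon _ _ ?_)
  rw [dotJ_add, dotJ_single, (mem_Lam.1 ha).1]
  omega

/-! ### Sums over fixed `a · n` -/

section FirstKind

/-- The specialization `f^(i) ↦ 1`, `g^(k) ↦ X^k`. -/
noncomputable def specOne : DiffPoly →ₐ[ℤ] Polynomial ℤ :=
  aeval (Sum.elim (fun _ => 1) fun k => Polynomial.X ^ k)

theorem specOne_fgMonomial (b : ℕ →₀ ℕ) (k : ℕ) :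
    specOne (fgMonomial b k) = Polynomial.X ^ k := by
  rw [specOne, fgMonomial, aeval_monomial, Finsupp.prod_sumElim]
  simp [Finsupp.prod]

/-- On a monomial with `g^(k)`, differentiating `g` gives `X^(k+1)`, and each of the `p` factors
from `f` gives `X^k`. -/
theorem specOne_D_iterate_fD {p : ℕ} (hp : 1 ≤ p) :
    specOne (D (fD^[p] (X (Sum.inr 0)))) =
      (Polynomial.X + (p : Polynomial ℤ)) * specOne (fD^[p] (X (Sum.inr 0))) := by
  refine iterate_fD_induction hp
    (fun x => specOne (D x) = (Polynomial.X + (p : Polynomial ℤ)) * specOne x) (by simp)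
    (fun x y hx hy => by rw [map_add, map_add, hx, hy, map_add, mul_add])
    (fun c x hx => by rw [D.map_smul, map_smul, hx, map_smul, mul_smul_comm]) fun b k hb => ?_
  rw [D_fgMonomial, map_add, map_sum, specOne_fgMonomial, specOne_fgMonomial]
  simp only [map_smul, specOne_fgMonomial]
  rw [← Finset.sum_smul, ← hb, dotJ, Finsupp.sum, add_mul, pow_succ', zsmul_eq_mul]
  push_cast
  rfl

theorem coeff_specOne_iterate_fD {p : ℕ} (hp : 1 ≤ p) (m : ℕ) :
    (specOne (fD^[p] (X (Sum.inr 0)))).coeff m = Nat.stirlingFirst p m := by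
  induction p, hp using Nat.le_induction generalizing m with
  | base =>
    rw [Function.iterate_one, fD, map_mul, D, mkDerivation_X]
    simp only [specOne, aeval_X, Sum.map_inr, Sum.elim_inl, Sum.elim_inr, one_mul]
    rcases m with _ | _ | m <;> simp [Polynomial.coeff_X, Nat.stirlingFirst]
  | succ p hp ih =>
    rw [Function.iterate_succ_apply', fD, map_mul, specOne_D_iterate_fD hp, add_mul,
      ← Polynomial.C_eq_natCast]
    have : specOne (X (Sum.inl 0)) = 1 := by simp [specOne]
    rw [this, one_mul, Polynomial.coeff_add, Polynomial.coeff_C_mul, ih]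
    rcases m with _ | m
    · obtain ⟨q, rfl⟩ : ∃ q, p = q + 1 := ⟨p - 1, by omega⟩
      simp
    · rw [Polynomial.coeff_X_mul, ih, Nat.stirlingFirst_succ_succ]
      push_cast
      ring

theorem sum_gamma_eq_stirlingFirst {p : ℕ} (hp : 1 ≤ p) (m : ℕ) :
    (∑ a ∈ (Lam p).filter (fun a => dotN a + m = p), gamma p a) = Nat.stirlingFirst p m := by
  rw [← coeff_specOne_iterate_fD hp, iterate_fD_eq_sum hp, map_sum, Polynomial.finsetSum_coeff,
    Finset.sum_filter]
  refine Finset.sum_congr rfl fun a ha => ?_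
  have := (mem_Lam.1 ha).2
  rw [map_smul, expansionMonomial, specOne_fgMonomial, Polynomial.coeff_smul,
    Polynomial.coeff_X_pow, smul_eq_mul, mul_ite, mul_one, mul_zero]
  exact if_congr (by omega) rfl rfl

end FirstKind

/-! ### Sums over fixed `a 0` -/

section Eulerian

/-- The specialization `f ↦ X`, `f^(i) ↦ 1` for `i ≥ 1` and `g^(k) ↦ 1`. -/
noncomputable def specX : DiffPoly →ₐ[ℤ] Polynomial ℤ :=
  aeval (Sum.elim (fun i => if i = 0 then Polynomial.X else 1) fun _ => 1)

theorem specX_fgMonomial (b : ℕ →₀ ℕ) (k : ℕ) :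
    specX (fgMonomial b k) = Polynomial.X ^ b 0 := by
  rw [specX, fgMonomial, aeval_monomial, Finsupp.prod_sumElim, map_one, one_mul, Finsupp.prod,
    Finset.prod_eq_single 0]
  · simp
  · intro i _ hi
    simp [hi]
  · intro h
    simp [Finsupp.notMem_support_iff.1 h]

/-- With `n = b 0`, differentiating one of the `n` factors `f` gives `X^(n-1)`; differentiating any
of the other `p - n` factors, or `g`, gives `X^n`. The total is `(p+1-n) X^n + n X^(n-1)`. -/
theorem specX_D_iterate_fD {p : ℕ} (hp : 1 ≤ p) :
    specX (D (fD^[p] (X (Sum.inr 0)))) =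
      Polynomial.C ((p : ℤ) + 1) * specX (fD^[p] (X (Sum.inr 0))) +
        (1 - Polynomial.X) * Polynomial.derivative (specX (fD^[p] (X (Sum.inr 0)))) := by
  refine iterate_fD_induction hp
    (fun x => specX (D x) = Polynomial.C ((p : ℤ) + 1) * specX x +
      (1 - Polynomial.X) * Polynomial.derivative (specX x)) (by simp)
    (fun x y hx hy => by simp only [map_add, hx, hy]; ring)
    (fun c x hx => by
      rw [D.map_smul, map_smul, hx, map_smul, Polynomial.derivative_smul, mul_smul_comm,
        mul_smul_comm, smul_add]) fun b k hb => ?_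
  rw [D_fgMonomial, map_add, map_sum, specX_fgMonomial, specX_fgMonomial]
  simp only [map_smul, specX_fgMonomial]
  have h1 : ∀ i ∈ b.support, (b i : ℤ) •
      (Polynomial.X : Polynomial ℤ) ^
        ((b - Finsupp.single i 1 + Finsupp.single (i + 1) 1 : ℕ →₀ ℕ) 0) =
      (b i : ℤ) • Polynomial.X ^ b 0 + if i = 0 then
        (b 0 : ℤ) • (Polynomial.X ^ (b 0 - 1) - Polynomial.X ^ b 0) else 0 := by
    intro i _
    rcases eq_or_ne i 0 with rfl | hi
    · simp [smul_sub]
    · simp [hi]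
  rw [Finset.sum_congr rfl h1, Finset.sum_add_distrib, ← Finset.sum_smul, Finset.sum_ite_eq',
    ← Nat.cast_sum]
  have h2 : ∑ i ∈ b.support, b i = p := hb
  rw [h2]
  have h3 : (if 0 ∈ b.support then
      (b 0 : ℤ) • ((Polynomial.X : Polynomial ℤ) ^ (b 0 - 1) - Polynomial.X ^ b 0) else 0) =
      (b 0 : ℤ) • (Polynomial.X ^ (b 0 - 1) - Polynomial.X ^ b 0) := by
    split_ifs with h
    · rfl
    · simp [Finsupp.notMem_support_iff.1 h]
  rw [h3, Polynomial.derivative_X_pow]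
  rcases b 0 with _ | n
  · simp
    ring
  · simp only [Nat.add_sub_cancel, zsmul_eq_mul, map_add, map_one, map_natCast]
    push_cast
    ring

/-- The index shift comes from the extra factor `f` in `f^(a + e_0)`. -/
theorem coeff_specX_iterate_fD {p : ℕ} (hp : 1 ≤ p) (m : ℕ) :
    (specX (fD^[p] (X (Sum.inr 0)))).coeff (m + 1) = eulerian p m := by
  have hX : specX (X (Sum.inl 0)) = Polynomial.X := by simp [specX]
  induction p, hp using Nat.le_induction generalizing m with
  | base =>
    rw [Function.iterate_one, fD, map_mul, D, mkDerivation_X, hX, Polynomial.coeff_X_mul]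
    rcases m with _ | m
    · rw [eulerian_succ_zero, eulerian_zero]; simp [specX]
    · rw [eulerian_succ_succ, eulerian_zero, eulerian_zero]
      rcases m with _ | m <;> simp [specX, Polynomial.coeff_one]
  | succ p hp ih =>
    have h0 : (specX (fD^[p] (X (Sum.inr 0)))).coeff 0 = 0 := by
      obtain ⟨q, rfl⟩ : ∃ q, p = q + 1 := ⟨p - 1, by omega⟩
      rw [Function.iterate_succ_apply', fD, map_mul, hX, Polynomial.coeff_X_mul_zero]
    rw [Function.iterate_succ_apply', fD, map_mul, hX, Polynomial.coeff_X_mul,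
      specX_D_iterate_fD hp, Polynomial.coeff_add, Polynomial.coeff_C_mul, sub_mul, one_mul,
      Polynomial.coeff_sub, Polynomial.coeff_derivative, ih]
    rcases m with _ | m
    · rw [h0, eulerian_succ_zero]
      simp
    · rw [Polynomial.coeff_X_mul, Polynomial.coeff_derivative, ih, eulerian_succ_succ]
      push_cast
      ring

theorem sum_gamma_eq_eulerian {p : ℕ} (hp : 1 ≤ p) (m : ℕ) :
    (∑ a ∈ (Lam p).filter (fun a => a 0 = m), gamma p a) = eulerian p m := by
  rw [← coeff_specX_iterate_fD hp, iterate_fD_eq_sum hp, map_sum, Polynomial.finsetSum_coeff,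
    Finset.sum_filter]
  refine Finset.sum_congr rfl fun a _ => ?_
  rw [map_smul, expansionMonomial, specX_fgMonomial, Polynomial.coeff_smul,
    Polynomial.coeff_X_pow, smul_eq_mul, mul_ite, mul_one, mul_zero]
  refine if_congr ?_ rfl rfl
  simp [eq_comm]

end Eulerian

/-! ### Coefficient recurrences and the two explicit coefficients -/

/-- Leibniz read backwards: a monomial of `D h` arises by lowering one variable by one order, with
multiplicity the exponent of the lowered variable in the predecessor. `S` may be any finite set
containing the contributing variables. -/
theorem coeff_D (h : DiffPoly) (t : ℕ ⊕ ℕ →₀ ℕ) (S : Finset (ℕ ⊕ ℕ))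
    (hS : ∀ j, t (Sum.map Nat.succ Nat.succ j) ≠ 0 → j ∈ S) :
    coeff t (D h) = ∑ j ∈ S, if t (Sum.map Nat.succ Nat.succ j) = 0 then 0 else
      (((t - Finsupp.single (Sum.map Nat.succ Nat.succ j) 1 : ℕ ⊕ ℕ →₀ ℕ) j : ℤ) + 1) *
        coeff (t - Finsupp.single (Sum.map Nat.succ Nat.succ j) 1 + Finsupp.single j 1) h := by
  induction h using MvPolynomial.induction_on' with
  | add p q hp hq =>
    rw [map_add, coeff_add, hp, hq, ← Finset.sum_add_distrib]
    refine Finset.sum_congr rfl fun j _ => ?_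
    split_ifs
    · rfl
    · rw [coeff_add, mul_add]
  | monomial s r =>
    rw [D, mkDerivation_monomial, coeff_smul, Finsupp.sum, coeff_sum, smul_eq_mul, Finset.mul_sum]
    -- Both sums are extended by zeros to the union of their index sets and compared termwise.
    rw [Finset.sum_subset (Finset.subset_union_left (s₂ := S)),
      Finset.sum_subset (Finset.subset_union_right (s₁ := s.support) (s₂ := S))]
    · refine Finset.sum_congr rfl fun j _ => ?_
      rw [smul_eq_mul, coeff_mul_X', coeff_monomial, coeff_monomial]
      simp only [Finsupp.mem_support_iff, ite_not]
      rcases eq_or_ne (t (Sum.map Nat.succ Nat.succ j)) 0 with h1 | h1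
      · rw [if_pos h1, if_pos h1, mul_zero]
      rw [if_neg h1, if_neg h1]
      generalize t - Finsupp.single (Sum.map Nat.succ Nat.succ j) 1 = u
      rcases eq_or_ne s (u + Finsupp.single j 1) with rfl | h2
      · simp [mul_comm]
      · rw [if_neg h2, mul_zero]
        split_ifs with h3
        · have : s j = 0 := by
            by_contra h4
            exact h2 (by rw [← h3, tsub_add_cancel_of_le
              (Finsupp.single_le_iff.2 (Nat.one_le_iff_ne_zero.2 h4))])
          simp [this]
        · simp
    · intro j _ hj
      rw [if_pos (not_not.1 (mt (hS j) hj))]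
    · intro j _ hj
      simp [Finsupp.notMem_support_iff.1 hj]

theorem coeff_D_fgMonomial (h : DiffPoly) (b : ℕ →₀ ℕ) (k : ℕ) (T : Finset ℕ)
    (hT : ∀ i, b (i + 1) ≠ 0 → i ∈ T) :
    coeff (Finsupp.sumElim b (Finsupp.single (k + 1) 1)) (D h) =
      coeff (Finsupp.sumElim b (Finsupp.single k 1)) h +
      ∑ i ∈ T, if b (i + 1) = 0 then 0 else
        (((b - Finsupp.single (i + 1) 1 : ℕ →₀ ℕ) i : ℤ) + 1) *
          coeff (Finsupp.sumElim (b - Finsupp.single (i + 1) 1 + Finsupp.single i 1)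
            (Finsupp.single (k + 1) 1)) h := by
  rw [coeff_D h _ (T.disjSum {k}), Finset.sum_disjSum, add_comm]
  · congr 1
    · rw [Finset.sum_singleton, if_neg (by simp)]
      have h1 : Finsupp.sumElim b (Finsupp.single (k + 1) 1) -
          Finsupp.single (Sum.map Nat.succ Nat.succ (Sum.inr k)) 1 = Finsupp.sumElim b 0 := by
        ext (j | j) <;> simp [Finsupp.single_apply]
      have h2 : Finsupp.sumElim b 0 + Finsupp.single (Sum.inr k) 1 =
          Finsupp.sumElim b (Finsupp.single k 1) := by
        ext (j | j) <;> simp [Finsupp.single_apply]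
      rw [h1, h2]
      simp
    · refine Finset.sum_congr rfl fun i _ => ?_
      have h1 : Finsupp.sumElim b (Finsupp.single (k + 1) 1) -
          Finsupp.single (Sum.map Nat.succ Nat.succ (Sum.inl i)) 1 =
            Finsupp.sumElim (b - Finsupp.single (i + 1) 1) (Finsupp.single (k + 1) 1) := by
        ext (j | j) <;> simp [Finsupp.single_apply]
      have h2 : Finsupp.sumElim (b - Finsupp.single (i + 1) 1) (Finsupp.single (k + 1) 1) +
          Finsupp.single (Sum.inl i) 1 = Finsupp.sumElim
            (b - Finsupp.single (i + 1) 1 + Finsupp.single i 1) (Finsupp.single (k + 1) 1) := by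
        ext (j | j) <;> simp [Finsupp.single_apply]
      rw [h1, h2]
      rfl
  · rintro (i | i) hi
    · exact Finset.inl_mem_disjSum.2 (hT i hi)
    · refine Finset.inr_mem_disjSum.2 ?_
      by_contra hne
      apply hi
      simp [Finsupp.single_apply]
      simp at hne
      omega

theorem coeff_fD (h : DiffPoly) (b : ℕ →₀ ℕ) (c : ℕ →₀ ℕ) :
    coeff (Finsupp.sumElim (b + Finsupp.single 0 1) c) (fD h) =
      coeff (Finsupp.sumElim b c) (D h) := by
  have : Finsupp.sumElim (b + Finsupp.single 0 1) c =
      Finsupp.single (Sum.inl 0) 1 + Finsupp.sumElim b c := by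
    ext (j | j) <;> simp [Finsupp.single_apply, add_comm]
  rw [fD, this, coeff_X_mul]

/-- After removing a leading `f`, the predecessors of `f^m f'^q g^(m+1)` are `f^m f'^q g^(m)` and,
with multiplicity `m + 1`, `f^(m+1) f'^(q-1) g^(m+1)` (exponents of `f` and `f'` are powers here).
This is the Stirling recurrence. -/
theorem coeff_iterate_fD_zero_one (m q : ℕ) :
    coeff (Finsupp.sumElim (Finsupp.single 0 m + Finsupp.single 1 q) (Finsupp.single m 1))
      (fD^[m + q] (X (Sum.inr 0))) = Nat.stirlingSecond (m + q) m := by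
  obtain ⟨p, hp⟩ : ∃ p, p = m + q := ⟨_, rfl⟩
  induction p generalizing m q with
  | zero =>
    obtain rfl : m = 0 := by omega
    obtain rfl : q = 0 := by omega
    simp [coeff_X]
  | succ p ih =>
    rcases m with _ | m
    · obtain ⟨q, rfl⟩ : ∃ n, q = n + 1 := ⟨p, by omega⟩
      rw [coeff_iterate_fD_eq_zero (by omega), zero_add, Nat.stirlingSecond_succ_zero,
        Nat.cast_zero]
    · obtain rfl : p = m + q := by omega
      have hb : (Finsupp.single 0 (m + 1) + Finsupp.single 1 q : ℕ →₀ ℕ) =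
          Finsupp.single 0 m + Finsupp.single 1 q + Finsupp.single 0 1 := by
        rw [Finsupp.single_add]; abel
      rw [← hp, Function.iterate_succ_apply', hb, coeff_fD,
        coeff_D_fgMonomial _ _ _ {0}, Finset.sum_singleton, ih m q rfl,
        Nat.stirlingSecond_succ_succ, add_comm, Nat.cast_add, Nat.cast_mul]
      · congr 1
        rcases q with _ | q
        -- Without a factor `f'` the second predecessor is absent, matching a vanishing Stirling
        -- number.
        · simp [Nat.stirlingSecond_eq_zero_of_lt]
        · have hc : (Finsupp.single 0 m + Finsupp.single 1 (q + 1) - Finsupp.single (0 + 1) 1 :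
              ℕ →₀ ℕ) = Finsupp.single 0 m + Finsupp.single 1 q := by
            rw [Finsupp.single_add 1 q 1, ← add_assoc, zero_add, add_tsub_cancel_right]
          have hd : (Finsupp.single 0 m + Finsupp.single 1 q + Finsupp.single 0 1 : ℕ →₀ ℕ) =
              Finsupp.single 0 (m + 1) + Finsupp.single 1 q := by
            rw [Finsupp.single_add]; abel
          have := ih (m + 1) q (by omega)
          rw [show m + 1 + q = m + (q + 1) by omega] at this
          rw [if_neg (by simp), hc, hd, this]
          simp
      · intro i hi
        by_contra hne
        apply hi
        simp at hne
        simp [Finsupp.single_apply]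
        omega

/-- Lowering the order of `g` or that of the single factor `f^(m)` gives the two terms of Pascal's
rule. -/
theorem coeff_iterate_fD_zero_self {m : ℕ} (hm : 1 ≤ m) (k : ℕ) :
    coeff (Finsupp.sumElim (Finsupp.single 0 (m + k - 1) + Finsupp.single m 1)
      (Finsupp.single k 1)) (fD^[m + k] (X (Sum.inr 0))) = (m + k).choose (m + 1) := by
  obtain ⟨p, hp⟩ : ∃ p, p = m + k := ⟨_, rfl⟩
  induction p generalizing m k with
  | zero => omega
  | succ p ih =>
    rcases k with _ | k
    · rw [coeff_iterate_fD_eq_zero (by omega), add_zero, Nat.choose_succ_self, Nat.cast_zero]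
    · obtain rfl : p = m + k := by omega
      have hb : (Finsupp.single 0 (m + (k + 1) - 1) + Finsupp.single m 1 : ℕ →₀ ℕ) =
          Finsupp.single 0 (m + k - 1) + Finsupp.single m 1 + Finsupp.single 0 1 := by
        rw [show m + (k + 1) - 1 = m + k - 1 + 1 by omega, Finsupp.single_add]; abel
      obtain ⟨n, rfl⟩ : ∃ n, m = n + 1 := ⟨m - 1, by omega⟩
      rw [hb, ← hp, Function.iterate_succ_apply', coeff_fD,
        coeff_D_fgMonomial _ _ _ {n}, Finset.sum_singleton, ih hm k rfl,
        Nat.choose_succ_succ, add_comm, Nat.cast_add, if_neg (by simp), add_tsub_cancel_right]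
      · congr 1
        rcases n with _ | n
        -- Lowering `f'` merges it into a pure power of `f`: the multiplicity is `k + 1`, and the
        -- predecessor's coefficient is `1`.
        · have := coeff_iterate_fD_zero_one (k + 1) 0
          rw [← Finsupp.single_add, show 0 + 1 + k - 1 + 1 = k + 1 by omega,
            show 0 + 1 + k = k + 1 + 0 by omega]
          rw [Finsupp.single_zero, add_zero] at this
          rw [this, Nat.stirlingSecond_self]
          simp
        · have := ih (m := n + 1) (by omega) (k + 1) (by omega)
          rw [show n + 1 + (k + 1) = n + 1 + 1 + k by omega] at this
          rw [this]
          simp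
      · intro i hi
        by_contra hne
        apply hi
        simp at hne
        simp [Finsupp.single_apply]
        omega

theorem gamma_zero_self {p m : ℕ} (hm : 1 ≤ m) (hmp : m ≤ p - 1) :
    gamma p (Finsupp.single 0 (p - 2) + Finsupp.single m 1) = p.choose (m + 1) := by
  have hN : dotN (Finsupp.single 0 (p - 2) + Finsupp.single m 1) = m := by
    rw [dotN_add, dotN_single, dotN_single]; omega
  have hJ : dotJ (Finsupp.single 0 (p - 2) + Finsupp.single m 1) = p - 1 := by
    rw [dotJ_add, dotJ_single, dotJ_single]; omega
  rw [gamma, if_pos (mem_Lam.2 ⟨hJ, by omega⟩), hN]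
  have := coeff_iterate_fD_zero_self hm (p - m)
  rw [show m + (p - m) = p by omega] at this
  rw [← this, add_right_comm, ← Finsupp.single_add, show p - 2 + 1 = p - 1 by omega]

theorem gamma_zero_one {p m : ℕ} (hm : 1 ≤ m) (hmp : m ≤ p) :
    gamma p (Finsupp.single 0 (m - 1) + Finsupp.single 1 (p - m)) = Nat.stirlingSecond p m := by
  have hN : dotN (Finsupp.single 0 (m - 1) + Finsupp.single 1 (p - m)) = p - m := by
    rw [dotN_add, dotN_single, dotN_single]; omega
  have hJ : dotJ (Finsupp.single 0 (m - 1) + Finsupp.single 1 (p - m)) = p - 1 := by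
    rw [dotJ_add, dotJ_single, dotJ_single]; omega
  rw [gamma, if_pos (mem_Lam.2 ⟨hJ, by omega⟩), hN]
  have := coeff_iterate_fD_zero_one m (p - m)
  rw [show m + (p - m) = p by omega] at this
  rw [← this, add_right_comm, ← Finsupp.single_add, show m - 1 + 1 = m by omega,
    show p - (p - m) = m by omega]

end Scherk

theorem mainTheorem5 (p : ℕ) (hp : 1 ≤ p) :
    (∀ m : ℕ, 1 ≤ m → m ≤ p - 1 →
      Scherk.gamma p (Finsupp.single 0 (p - 2) + Finsupp.single m 1) = (p.choose (m + 1) : ℤ)) ∧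
    (∀ m : ℕ, 1 ≤ m → m ≤ p →
      Scherk.gamma p (Finsupp.single 0 (m - 1) + Finsupp.single 1 (p - m)) =
          (Nat.stirlingSecond p m : ℤ) ∧
        Nat.stirlingSecond p m = Scherk.numSetPartitions p m) ∧
    (∀ m : ℕ,
      (∑ a ∈ (Scherk.Lam p).filter (fun a => Scherk.dotN a + m = p), Scherk.gamma p a) =
          (Nat.stirlingFirst p m : ℤ) ∧
        Nat.stirlingFirst p m = Scherk.numPermsByCycles p m) ∧
    (∀ m : ℕ,
      (∑ a ∈ (Scherk.Lam p).filter (fun a => a 0 = m), Scherk.gamma p a) =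
        (Scherk.eulerian p m : ℤ)) :=
  ⟨fun _ h1 h2 => Scherk.gamma_zero_self h1 h2,
    fun m h1 h2 => ⟨Scherk.gamma_zero_one h1 h2,
      (Scherk.numSetPartitions_eq_stirlingSecond p m).symm⟩,
    fun m => ⟨Scherk.sum_gamma_eq_stirlingFirst hp m,
      (Scherk.numPermsByCycles_eq_stirlingFirst p m).symm⟩,
    fun m => Scherk.sum_gamma_eq_eulerian hp m⟩
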